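/- **Corollary 1.6.** Let $X$ be an injective (equivalently, hyperconvex) metric space: every nonexpansive map from a subset of a metric space $B$ into $X$ extends to a nonexpansive map $B\to X$. (1) Let $x_0\in X$, let $\mathrm{Hom}(X,\mathbb R)$ be the space of nonexpansive functions $X\to\mathbb R$ with the topology of pointwise convergence, and let the metric compactification $\overline X$ be the closure in it of $\{h_x : x\in X\}$, where $h_x(y)=d(y,x)-d(x_0,x)$. Then for every isometry (distance-preserving bijection) $T:X\to X$ there is $h\in\overline X$ with $Th=h$, where $(Th)(x)=h(T^{-1}x)-h(T^{-1}x_0)$. (2) Suppose moreover that $X$ is proper, and let $\sigma$ be a conical and consistent geodesic bicombing on $X$, that is, a choice of constant speed geodesics $\sigma_{xy}:[0,1]\to X$ from $x$ to $y$ such that $$d(\sigma_{xy}(t),\sigma_{x'y'}(t))\le (1-t)\,d(x,x')+t\,d(y,y')$$ for all $x,y,x',y'\in X$ and $t\in[0,1]$, and $\sigma_{pq}(\lambda)=\sigma_{xy}((1-\lambda)s+\lambda t)$ whenever $p=\sigma_{xy}(s)$, $q=\sigma_{xy}(t)$, $0\le s\le t\le 1$ and $\lambda\in[0,1]$. A $\sigma$-ray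 is an isometric embedding $\xi:[0,\infty)\to X$ with $\xi((1-\lambda)s+\lambda t)=\sigma_{\xi(s)\xi(t)}(\lambda)$ for all $0\le s\le t$ and $\lambda\in[0,1]$; two $\sigma$-rays $\xi,\eta$ are asymptotic if $\sup_t d(\xi(t),\eta(t))<\infty$. The (Descombes–Lang) visual compactification $\overline X_\sigma$ is the disjoint union of $X$ and the set of asymptote classes of $\sigma$-rays. Its topology is that of uniform convergence on compact sets of the generalized rays $\varrho_{oz}:[0,\infty)\to X$ from a base point $o\in X$ to $z\in\overline X_\sigma$. Here, for $z\in X$, $\varrho_{oz}$ follows $\sigma_{oz}$ with unit speed and then stays at $z$; for a class $z$, it is the $\sigma$-ray in $z$ that starts at $o$. Then every isometry $T$ of $X$ that acts on $\overline X_\sigma$ fixes a point of $\overline X_\sigma$. Precisely: - if $T$ preserves $\sigma$, that is, $T\circ\sigma_{xy}=\sigma_{Tx\,Ty}$ for all $x,y\in X$, then the induced map $x\mapsto Tx$, $[\xi]\mapsto[T\circ\xi]$ of $\overline X_\sigma$ has a fixed point; - for every isometry $T$ of $X$ (whether or not it preserves $\sigma$) and every $o\in X$, every continuous map $\overline X_\sigma\to\overline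 X_\sigma$ that extends $T$ has a fixed point. -/

import Mathlib

open Set Topology
open scoped NNReal

universe u

noncomputable section

/-- A metric space `X` is injective: every nonexpansive map into `X` from a subset of a metric
space `B` extends to a nonexpansive map on `B`.  (Testing on spaces `B` in the universe of `X` is
enough: one-point extensions of subsets of `X` already detect hyperconvexity of `X`, which is
equivalent to injectivity with respect to all metric spaces.) -/
def IsInjectiveMetricSpace (X : Type u) [MetricSpace X] : Prop :=
  ∀ (B : Type u) [MetricSpace B] (A : Set B) (f : A → X), LipschitzWith 1 f →
    ∃ g : B → X, LipschitzWith 1 g ∧ ∀ a : A, g a = f a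

section MetricCompactification

variable {X : Type u} [MetricSpace X]

/-- The space `Hom(X, ℝ)` of nonexpansive functions; as a subtype of `X → ℝ` it carries the
topology of pointwise convergence. -/
abbrev NonexpansiveFunction (X : Type u) [MetricSpace X] : Type u :=
  {h : X → ℝ // LipschitzWith 1 h}

/-- The map `Φ : x ↦ h_x`, where `h_x(y) = d(y, x) - d(x₀, x)`. -/
def metricEmbedding (x₀ x : X) : NonexpansiveFunction X :=
  ⟨fun y => dist y x - dist x₀ x, LipschitzWith.of_dist_le_mul fun y z => by
    have := abs_dist_sub_le y z x
    simpa [Real.dist_eq] using this⟩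

/-- The metric compactification of `X` (with base point `x₀`): the closure of `Φ(X)` in
`Hom(X, ℝ)`.  Its elements are the metric functionals. -/
def MetricCompactification (x₀ : X) : Type u :=
  closure (range (metricEmbedding x₀))

/-- The map `h ↦ Th` on functions, `(Th)(x) = h(T⁻¹x) - h(T⁻¹x₀)`. -/
def translateFunction (x₀ : X) (T : X ≃ᵢ X) (h : NonexpansiveFunction X) :
    NonexpansiveFunction X :=
  ⟨fun x => h.1 (T.symm x) - h.1 (T.symm x₀), LipschitzWith.of_dist_le_mul fun y z => by
    have := h.2.dist_le_mul (T.symm y) (T.symm z)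
    rw [T.symm.dist_eq] at this
    simpa using this⟩

theorem continuous_translateFunction (x₀ : X) (T : X ≃ᵢ X) :
    Continuous (translateFunction x₀ T) := by
  refine Continuous.subtype_mk (continuous_pi fun x => ?_) _
  exact ((continuous_apply (T.symm x)).comp continuous_subtype_val).sub
    ((continuous_apply (T.symm x₀)).comp continuous_subtype_val)

theorem translateFunction_metricEmbedding (x₀ : X) (T : X ≃ᵢ X) (x : X) :
    translateFunction x₀ T (metricEmbedding x₀ x) = metricEmbedding x₀ (T x) := by
  apply Subtype.ext
  funext y
  have h1 : ∀ z, dist (T.symm z) x = dist z (T x) := fun z => by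
    rw [← T.dist_eq (T.symm z) x, T.apply_symm_apply]
  simp [translateFunction, metricEmbedding, h1]

theorem translateFunction_mem (x₀ : X) (T : X ≃ᵢ X) {h : NonexpansiveFunction X}
    (hh : h ∈ closure (range (metricEmbedding x₀))) :
    translateFunction x₀ T h ∈ closure (range (metricEmbedding x₀)) := by
  refine map_mem_closure (continuous_translateFunction x₀ T) hh ?_
  rintro _ ⟨x, rfl⟩
  exact ⟨T x, (translateFunction_metricEmbedding x₀ T x).symm⟩

/-- The action of an isometry `T` of `X` on the metric compactification. -/
def MetricCompactification.act {x₀ : X} (T : X ≃ᵢ X) (h : MetricCompactification x₀) :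
    MetricCompactification x₀ :=
  ⟨translateFunction x₀ T h.1, translateFunction_mem x₀ T h.2⟩

end MetricCompactification

/-- A geodesic bicombing: a choice, for all `x, y`, of a constant speed geodesic
`σ x y : [0, 1] → X` from `x` to `y`.  Only the values at times in `[0, 1]` matter. -/
structure GeodesicBicombing (X : Type u) [MetricSpace X] where
  toFun : X → X → ℝ → X
  map_zero : ∀ x y, toFun x y 0 = x
  map_one : ∀ x y, toFun x y 1 = y
  dist_map : ∀ x y, ∀ s ∈ Icc (0 : ℝ) 1, ∀ t ∈ Icc (0 : ℝ) 1,
    dist (toFun x y s) (toFun x y t) = |s - t| * dist x y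

namespace GeodesicBicombing

variable {X : Type u} [MetricSpace X]

/-- The bicombing is conical. -/
def IsConical (σ : GeodesicBicombing X) : Prop :=
  ∀ x y x' y' : X, ∀ t ∈ Icc (0 : ℝ) 1,
    dist (σ.toFun x y t) (σ.toFun x' y' t) ≤ (1 - t) * dist x x' + t * dist y y'

/-- The bicombing is consistent: subsegments of distinguished geodesics are distinguished. -/
def IsConsistent (σ : GeodesicBicombing X) : Prop :=
  ∀ x y : X, ∀ s ∈ Icc (0 : ℝ) 1, ∀ t ∈ Icc (0 : ℝ) 1, s ≤ t → ∀ l ∈ Icc (0 : ℝ) 1,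
    σ.toFun (σ.toFun x y s) (σ.toFun x y t) l = σ.toFun x y ((1 - l) * s + l * t)

/-- The isometry `T` maps distinguished geodesics to distinguished geodesics. -/
def IsEquivariant (σ : GeodesicBicombing X) (T : X ≃ᵢ X) : Prop :=
  ∀ x y : X, ∀ t ∈ Icc (0 : ℝ) 1, T (σ.toFun x y t) = σ.toFun (T x) (T y) t

/-- A `σ`-ray: an isometric embedding `[0, ∞) → X` all of whose subsegments, suitably
reparametrized, are distinguished geodesics. -/
structure Ray (σ : GeodesicBicombing X) where
  toFun : ℝ≥0 → X
  isometry : Isometry toFun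
  map_eq : ∀ s t r : ℝ≥0, s ≤ t → ∀ l ∈ Icc (0 : ℝ) 1, (r : ℝ) = (1 - l) * s + l * t →
    toFun r = σ.toFun (toFun s) (toFun t) l

/-- Two `σ`-rays are asymptotic if they stay at bounded distance from each other. -/
def asymptotic (σ : GeodesicBicombing X) : Setoid σ.Ray where
  r ξ η := ∃ C : ℝ, ∀ t, dist (ξ.toFun t) (η.toFun t) ≤ C
  iseqv :=
    { refl := fun ξ => ⟨0, fun t => by simp⟩
      symm := fun ⟨C, hC⟩ => ⟨C, fun t => by rw [dist_comm]; exact hC t⟩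
      trans := fun ⟨C, hC⟩ ⟨D, hD⟩ =>
        ⟨C + D, fun t => (dist_triangle _ _ _).trans (add_le_add (hC t) (hD t))⟩ }

/-- The boundary at infinity `∂_σ X`: the set of asymptote classes of `σ`-rays. -/
def Boundary (σ : GeodesicBicombing X) : Type u := Quotient σ.asymptotic

/-- The point at infinity of a `σ`-ray. -/
def Ray.endpoint {σ : GeodesicBicombing X} (ξ : σ.Ray) : σ.Boundary :=
  Quotient.mk σ.asymptotic ξ

/-- The underlying set of the visual compactification of `X` with respect to `σ`, the disjoint
union of `X` and `∂_σ X`.  Its topology is `coneTopology` below. -/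
inductive VisualCompactification (σ : GeodesicBicombing X) : Type u
  | ofPoint : X → VisualCompactification σ
  | ofBoundary : σ.Boundary → VisualCompactification σ

open scoped Classical in
/-- The generalized ray from `o` to `z`.  If `z` is a point of `X`, it runs along the
distinguished geodesic from `o` to `z` with unit speed and stays at `z` afterwards.  If `z` is a
point at infinity, it is the `σ`-ray from `o` in the class `z`; if `X` is complete and `σ` is
conical and consistent then there is exactly one such ray, and the last clause is never used. -/
def rayTo (σ : GeodesicBicombing X) (o : X) : σ.VisualCompactification → ℝ≥0 → X
  | .ofPoint x => fun t => if (t : ℝ) < dist o x then σ.toFun o x (t / dist o x) else x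
  | .ofBoundary z =>
      if h : ∃ ξ : σ.Ray, ξ.toFun 0 = o ∧ ξ.endpoint = z then h.choose.toFun else fun _ => o

/-- The cone topology on `X ∪ ∂_σ X`: uniform convergence on compact sets of the generalized rays
from the base point `o`. -/
@[reducible]
def coneTopology (σ : GeodesicBicombing X) (o : X) : TopologicalSpace σ.VisualCompactification :=
  TopologicalSpace.induced
    (fun z => UniformOnFun.ofFun {K : Set ℝ≥0 | IsCompact K} (σ.rayTo o z)) inferInstance

/-- The image of a `σ`-ray under an isometry that preserves `σ`. -/
def Ray.map {σ : GeodesicBicombing X} (T : X ≃ᵢ X) (hT : σ.IsEquivariant T) (ξ : σ.Ray) :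
    σ.Ray where
  toFun t := T (ξ.toFun t)
  isometry := T.isometry.comp ξ.isometry
  map_eq s t r hst l hl hr := by
    rw [ξ.map_eq s t r hst l hl hr, hT _ _ l hl]

/-- The action on the boundary, `[ξ] ↦ [T ∘ ξ]`. -/
def Boundary.map {σ : GeodesicBicombing X} (T : X ≃ᵢ X) (hT : σ.IsEquivariant T) :
    σ.Boundary → σ.Boundary :=
  Quotient.map (Ray.map T hT) fun _ _ ⟨C, hC⟩ =>
    ⟨C, fun t => (T.dist_eq _ _).trans_le (hC t)⟩

/-- The action on the visual compactification of an isometry `T` that preserves `σ`. -/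
def VisualCompactification.act {σ : GeodesicBicombing X} (T : X ≃ᵢ X)
    (hT : σ.IsEquivariant T) : σ.VisualCompactification → σ.VisualCompactification
  | .ofPoint x => .ofPoint (T x)
  | .ofBoundary z => .ofBoundary (Boundary.map T hT z)

end GeodesicBicombing

end

/-!
Both parts rest on one computation. Let `f` be the contraction with factor `r < 1` that moves every
point `z` to the point at parameter `r` on a conical geodesic from a base point `o` to `z`, and let
`x = x_r` be an (almost) fixed point of `f ∘ T`. Thus `x` lies between `o` and `T x`.

*Metric compactification.* In an injective space such contractions come from a nonexpansive
retraction of a function space onto `X` (`IsInjectiveMetricSpace.exists_conical_contraction`).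
Conicality bounds `d(y, Tx) - d(y, x)` from below by `d(x, Tx)` up to an error
`O((1 - r) (1 + d(y, o)))`, and the triangle inequality bounds it from above by `d(x, Tx)`. So
`T h_x - h_x` tends to `0` pointwise as `r → 1`
(`abs_metricEmbedding_sub_le`), and every cluster point of the functions `h_x` is fixed by `T`.

*Visual compactification.* Here `f z = σ_{oz}(r)`, and `X` is complete, so that `x_r` is an exact
fixed point. Let `r → 1` along an ultrafilter. If `x_r` stays bounded along it, then the limit is a
fixed point of `T` in `X`, because `d(x_r, T x_r) = (1 - r) d(o, T x_r)`. Otherwise, by consistency,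
the geodesics from `o` to `x_r` and to `T x_r` agree up to time `d(o, x_r) → ∞`, and both converge
to one `σ`-ray `ξ` issuing from `o` (`exists_tendsto_ray`). A continuous extension of `T` then
fixes the class of `ξ`, since the topology separates that class from all other points
(`eq_ofBoundary_endpoint`). If `T` preserves `σ`, then `T ∘ ξ` is the limit of the geodesics from
`T o` to `T x_r`, and conicality bounds its distance to `ξ`.
-/

open Filter

/-! ### Conical contractions in injective spaces -/

section Injective

variable {X : Type u} [MetricSpace X]

theorem IsInjectiveMetricSpace.nonempty (hX : IsInjectiveMetricSpace X) : Nonempty X := by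
  obtain ⟨g, -, -⟩ := hX PUnit ∅ (fun a => a.2.elim) fun a => a.2.elim
  exact ⟨g PUnit.unit⟩

/-- The Kuratowski embedding `x ↦ d(x, ·) - d(x₀, ·)` into the bounded continuous functions. -/
def kuratowskiBCF (x₀ x : X) : BoundedContinuousFunction X ℝ :=
  BoundedContinuousFunction.ofNormedAddCommGroup (fun y => dist x y - dist x₀ y)
    (by fun_prop) (dist x x₀) fun y => by
      rw [Real.norm_eq_abs]
      exact abs_dist_sub_le x x₀ y

theorem dist_kuratowskiBCF (x₀ x y : X) :
    dist (kuratowskiBCF x₀ x) (kuratowskiBCF x₀ y) = dist x y := by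
  apply le_antisymm
  · refine (BoundedContinuousFunction.dist_le dist_nonneg).2 fun z => ?_
    simpa [kuratowskiBCF, Real.dist_eq] using abs_dist_sub_le x y z
  · have := BoundedContinuousFunction.dist_coe_le_dist
      (f := kuratowskiBCF x₀ x) (g := kuratowskiBCF x₀ y) y
    simpa [kuratowskiBCF, Real.dist_eq] using this

theorem IsInjectiveMetricSpace.exists_retraction (hX : IsInjectiveMetricSpace X) (x₀ : X) :
    ∃ p : BoundedContinuousFunction X ℝ → X, LipschitzWith 1 p ∧
      ∀ x, p (kuratowskiBCF x₀ x) = x := by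
  choose e he using fun a : range (kuratowskiBCF x₀) => a.2
  obtain ⟨p, hp, hpe⟩ := hX _ (range (kuratowskiBCF x₀)) e
    (LipschitzWith.of_dist_le_mul fun a b => by
      rw [← dist_kuratowskiBCF x₀, he, he]
      simp [Subtype.dist_eq])
  refine ⟨p, hp, fun x => ?_⟩
  rw [hpe ⟨_, x, rfl⟩, ← dist_eq_zero, ← dist_kuratowskiBCF x₀, he, dist_self]

/-- An injective space has, for each `r ∈ [0, 1]`, a contraction towards `x₀` with factor `r` that
moves every point along a geodesic which satisfies the conical inequality with respect to all
points `y`. -/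
theorem IsInjectiveMetricSpace.exists_conical_contraction (hX : IsInjectiveMetricSpace X) (x₀ : X)
    {r : ℝ≥0} (hr : r ≤ 1) :
    ∃ f : X → X, LipschitzWith r f ∧ (∀ z, dist (f z) z ≤ (1 - r) * dist x₀ z) ∧
      ∀ y z, dist y (f z) ≤ (1 - r) * dist y x₀ + r * dist y z := by
  obtain ⟨p, hp, hpe⟩ := hX.exists_retraction x₀
  have hr' : (0 : ℝ) ≤ 1 - r := sub_nonneg.2 (by exact_mod_cast hr)
  set e := kuratowskiBCF x₀
  have hpd : ∀ a b, dist (p a) (p b) ≤ dist a b := fun a b => by simpa using hp.dist_le_mul a b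
  refine ⟨fun z => p ((1 - (r : ℝ)) • e x₀ + (r : ℝ) • e z),
    LipschitzWith.of_dist_le_mul fun z w => ?_, fun z => ?_, fun y z => ?_⟩
  · refine (hpd _ _).trans_eq ?_
    rw [dist_add_left, dist_eq_norm,
      show (r : ℝ) • e z - (r : ℝ) • e w = (r : ℝ) • (e z - e w) by module, norm_smul,
      Real.norm_of_nonneg r.coe_nonneg, ← dist_eq_norm, dist_kuratowskiBCF]
  · rw [← hpe z]
    refine (hpd _ _).trans_eq ?_
    rw [hpe z, ← dist_kuratowskiBCF x₀ x₀ z, dist_eq_norm, dist_eq_norm,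
      show (1 - (r : ℝ)) • e x₀ + (r : ℝ) • e z - e z = (1 - (r : ℝ)) • (e x₀ - e z) by module,
      norm_smul, Real.norm_of_nonneg hr']
  · rw [← hpe y]
    refine (hpd _ _).trans ?_
    rw [hpe y, ← dist_kuratowskiBCF x₀ y x₀, ← dist_kuratowskiBCF x₀ y z, dist_eq_norm,
      dist_eq_norm, dist_eq_norm,
      show e y - ((1 - (r : ℝ)) • e x₀ + (r : ℝ) • e z) =
        (1 - (r : ℝ)) • (e y - e x₀) + (r : ℝ) • (e y - e z) by module]
    refine (norm_add_le _ _).trans_eq ?_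
    rw [norm_smul, norm_smul, Real.norm_of_nonneg hr', Real.norm_of_nonneg r.coe_nonneg]

/-- A strict contraction has almost fixed points, even if the space is not complete. -/
theorem LipschitzWith.exists_dist_apply_le [Nonempty X] {r : ℝ≥0} (hr : r < 1) {f : X → X}
    (hf : LipschitzWith r f) {ε : ℝ} (hε : 0 < ε) : ∃ x, dist x (f x) ≤ ε := by
  obtain ⟨x⟩ := ‹Nonempty X›
  have h1 := (tendsto_pow_atTop_nhds_zero_of_lt_one r.2 (by exact_mod_cast hr)).const_mul
    (dist x (f x))
  rw [mul_zero] at h1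
  obtain ⟨n, hn⟩ := (h1.eventually (gt_mem_nhds hε)).exists
  refine ⟨f^[n] x, ?_⟩
  rw [← Function.iterate_succ_apply' f]
  exact (hf.dist_iterate_succ_le_geometric x n).trans hn.le

end Injective

/-! ### Fixed points in the metric compactification -/

section Metric

variable {X : Type u} [MetricSpace X]

/-- If `x` is almost fixed by `T` followed by a conical contraction `f` towards `x₀`, then the
functions `h_{Tx}` and `h_x` are almost equal, uniformly on bounded sets. -/
theorem abs_metricEmbedding_sub_le {x₀ : X} {r : ℝ} (hr : r < 1) {f : X → X}
    (hf : ∀ z, dist (f z) z ≤ (1 - r) * dist x₀ z)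
    (hf' : ∀ y z, dist y (f z) ≤ (1 - r) * dist y x₀ + r * dist y z) {x x' : X}
    (hx : dist x (f x') ≤ 1 - r) (y : X) :
    |(metricEmbedding x₀ x').1 y - (metricEmbedding x₀ x).1 y| ≤ (1 - r) * (2 + 2 * dist y x₀) := by
  have hr' : 0 ≤ 1 - r := by linarith
  have upper : ∀ y, dist y x' - dist y x ≤ (1 - r) * (1 + dist x₀ x') := fun y => by
    linarith [dist_triangle y x x', dist_triangle x (f x') x', hf x']
  have lower : ∀ y, (1 - r) * (dist x₀ x' - 2 * dist y x₀ - 1) ≤ dist y x' - dist y x := fun y => by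
    have h1 := mul_le_mul_of_nonneg_left (dist_triangle x₀ y x') hr'
    rw [dist_comm x₀ y] at h1
    have h2 := dist_triangle_right y x (f x')
    linarith [hf' y x']
  have u1 := upper y
  have u2 := upper x₀
  have l1 := lower y
  have l2 := lower x₀
  rw [dist_self] at l2
  have hy : 0 ≤ (1 - r) * dist y x₀ := mul_nonneg hr' dist_nonneg
  simp only [metricEmbedding, abs_le]
  constructor <;> linarith

/-- The functions `h_x` converge along every ultrafilter, since `h_x(y) ∈ [-d(y, x₀), d(y, x₀)]`. -/
theorem exists_tendsto_metricEmbedding {ι : Type*} (U : Ultrafilter ι) (x₀ : X) (x : ι → X) :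
    ∃ h : NonexpansiveFunction X, Tendsto (fun i => metricEmbedding x₀ (x i)) U (𝓝 h) := by
  have key : ∀ y, ∃ a, Tendsto (fun i => (metricEmbedding x₀ (x i)).1 y) U (𝓝 a) := fun y => by
    obtain ⟨a, -, ha⟩ := (isCompact_Icc (a := -dist y x₀) (b := dist y x₀)).ultrafilter_le_nhds
      (U.map fun i => (metricEmbedding x₀ (x i)).1 y)
      (tendsto_principal.2 <| Eventually.of_forall fun i => abs_le.1 (abs_dist_sub_le y x₀ (x i)))
    exact ⟨a, ha⟩
  choose h hh using key
  refine ⟨⟨h, LipschitzWith.of_dist_le_mul fun y z => ?_⟩,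
    tendsto_subtype_rng.2 (tendsto_pi_nhds.2 hh)⟩
  exact le_of_tendsto ((hh y).dist (hh z)) <| Eventually.of_forall fun i =>
    (metricEmbedding x₀ (x i)).2.dist_le_mul y z

theorem IsInjectiveMetricSpace.exists_act_eq (hX : IsInjectiveMetricSpace X) (x₀ : X)
    (T : X ≃ᵢ X) : ∃ h : MetricCompactification x₀, MetricCompactification.act T h = h := by
  have hne : Nonempty X := ⟨x₀⟩
  have key : ∀ r : ℝ, ∃ x, r ∈ Ico (0 : ℝ) 1 → ∀ y,
      |(metricEmbedding x₀ (T x)).1 y - (metricEmbedding x₀ x).1 y| ≤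
        (1 - r) * (2 + 2 * dist y x₀) := by
    intro r
    by_cases hr : r ∈ Ico (0 : ℝ) 1
    · lift r to ℝ≥0 using hr.1
      have hr1 : r < 1 := by exact_mod_cast hr.2
      obtain ⟨f, hf, hf1, hf2⟩ := hX.exists_conical_contraction x₀ hr1.le
      have hfT : LipschitzWith r (f ∘ T) := by simpa using hf.comp T.isometry.lipschitz
      obtain ⟨x, hx⟩ := hfT.exists_dist_apply_le hr1 (sub_pos.2 hr.2)
      exact ⟨x, fun _ => abs_metricEmbedding_sub_le hr.2 hf1 hf2 hx⟩
    · exact ⟨x₀, fun h => (hr h).elim⟩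
  choose x hx using key
  set U : Ultrafilter ℝ := Ultrafilter.of (𝓝[<] 1)
  have hU : (U : Filter ℝ) ≤ 𝓝[<] 1 := Ultrafilter.of_le _
  obtain ⟨h, hh⟩ := exists_tendsto_metricEmbedding U x₀ x
  have hT := ((continuous_translateFunction x₀ T).tendsto h).comp hh
  refine ⟨⟨h, mem_closure_of_tendsto hh (Eventually.of_forall fun r => ⟨x r, rfl⟩)⟩,
    Subtype.ext (Subtype.ext (funext fun y => ?_))⟩
  have eval : ∀ {g : ℝ → NonexpansiveFunction X} {k}, Tendsto g U (𝓝 k) →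
      Tendsto (fun r => (g r).1 y) U (𝓝 (k.1 y)) := fun hg =>
    tendsto_pi_nhds.1 (tendsto_subtype_rng.1 hg) y
  have hbound : Tendsto (fun r : ℝ => (1 - r) * (2 + 2 * dist y x₀)) U (𝓝 0) := by
    have : Continuous fun r : ℝ => (1 - r) * (2 + 2 * dist y x₀) := by fun_prop
    simpa using (this.tendsto 1).mono_left (hU.trans nhdsWithin_le_nhds)
  have hlim := (eval hT).sub (eval hh)
  refine sub_eq_zero.1 (tendsto_nhds_unique hlim (squeeze_zero_norm' ?_ hbound))
  filter_upwards [hU (Ico_mem_nhdsLT zero_lt_one)] with r hr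
  rw [Function.comp_apply, translateFunction_metricEmbedding]
  exact hx r hr y

end Metric

/-! ### Generalized rays and their limits -/

namespace GeodesicBicombing

variable {X : Type u} [MetricSpace X] {σ : GeodesicBicombing X}

theorem dist_toFun_right (x y : X) {r : ℝ} (hr : r ∈ Icc (0 : ℝ) 1) :
    dist (σ.toFun x y r) y = (1 - r) * dist x y := by
  have h := σ.dist_map x y r hr 1 (by simp)
  rwa [σ.map_one, abs_sub_comm, abs_of_nonneg (sub_nonneg.2 hr.2)] at h

theorem dist_left_toFun (x y : X) {r : ℝ} (hr : r ∈ Icc (0 : ℝ) 1) :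
    dist x (σ.toFun x y r) = r * dist x y := by
  have h := σ.dist_map x y 0 (by simp) r hr
  rwa [σ.map_zero, zero_sub, abs_neg, abs_of_nonneg hr.1] at h

theorem rayTo_ofPoint_of_le {o x : X} (hx : 0 < dist o x) {t : ℝ≥0} (ht : (t : ℝ) ≤ dist o x) :
    σ.rayTo o (.ofPoint x) t = σ.toFun o x (t / dist o x) := by
  rcases ht.lt_or_eq with h | h
  · simp [rayTo, h]
  · simp [rayTo, h, div_self hx.ne', σ.map_one]

theorem rayTo_ofPoint_of_ge {o x : X} {t : ℝ≥0} (ht : dist o x ≤ t) :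
    σ.rayTo o (.ofPoint x) t = x := by
  simp [rayTo, ht.not_gt]

theorem div_mem_Icc {t L : ℝ} (hL : 0 < L) (h0 : 0 ≤ t) (h1 : t ≤ L) : t / L ∈ Icc (0 : ℝ) 1 :=
  ⟨div_nonneg h0 hL.le, (div_le_one hL).2 h1⟩

theorem dist_rayTo_ofPoint {o x : X} (hx : 0 < dist o x) {s t : ℝ≥0} (hs : (s : ℝ) ≤ dist o x)
    (ht : (t : ℝ) ≤ dist o x) :
    dist (σ.rayTo o (.ofPoint x) s) (σ.rayTo o (.ofPoint x) t) = dist s t := by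
  rw [rayTo_ofPoint_of_le hx hs, rayTo_ofPoint_of_le hx ht,
    σ.dist_map _ _ _ (div_mem_Icc hx s.coe_nonneg hs) _ (div_mem_Icc hx t.coe_nonneg ht), ← sub_div, abs_div,
    abs_of_pos hx, div_mul_cancel₀ _ hx.ne', NNReal.dist_eq]

theorem lipschitzWith_rayTo_ofPoint (o x : X) : LipschitzWith 1 (σ.rayTo o (.ofPoint x)) := by
  rcases (dist_nonneg (x := o) (y := x)).eq_or_lt with hx | hx
  · have : σ.rayTo o (.ofPoint x) = fun _ => x :=
      funext fun t => rayTo_ofPoint_of_ge (hx.symm.le.trans t.2)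
    rw [this]
    exact (LipschitzWith.const x).weaken zero_le_one
  · -- A generalized ray is an isometric segment precomposed with truncation at its length.
    set L : ℝ≥0 := ⟨dist o x, hx.le⟩
    have hmin : ∀ t, σ.rayTo o (.ofPoint x) t = σ.rayTo o (.ofPoint x) (min t L) := fun t => by
      rcases le_total t L with h | h
      · rw [min_eq_left h]
      · rw [min_eq_right h, rayTo_ofPoint_of_ge (NNReal.coe_le_coe.2 h),
          rayTo_ofPoint_of_ge (t := L) le_rfl]
    refine LipschitzWith.of_dist_le_mul fun s t => ?_
    rw [hmin s, hmin t, dist_rayTo_ofPoint hx (NNReal.coe_le_coe.2 (min_le_right _ _))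
      (NNReal.coe_le_coe.2 (min_le_right _ _)), NNReal.dist_eq, NNReal.dist_eq, NNReal.coe_min,
      NNReal.coe_min, NNReal.coe_one, one_mul]
    simpa using abs_min_sub_min_le_max (s : ℝ) L t L

theorem rayTo_ofPoint_zero (o x : X) : σ.rayTo o (.ofPoint x) 0 = o := by
  rcases (dist_nonneg (x := o) (y := x)).eq_or_lt with hx | hx
  · rw [rayTo_ofPoint_of_ge (by simp [← hx]), dist_eq_zero.1 hx.symm]
  · rw [rayTo_ofPoint_of_le hx (by simp [hx.le])]
    simp [σ.map_zero]

/-- By consistency, all segments of the generalized ray to a point are distinguished geodesics. -/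
theorem IsConsistent.rayTo_ofPoint (hσ : σ.IsConsistent) {o x : X} (hx : 0 < dist o x)
    {s t q : ℝ≥0} (hst : s ≤ t) (ht : (t : ℝ) ≤ dist o x) {l : ℝ} (hl : l ∈ Icc (0 : ℝ) 1)
    (hq : (q : ℝ) = (1 - l) * s + l * t) :
    σ.rayTo o (.ofPoint x) q =
      σ.toFun (σ.rayTo o (.ofPoint x) s) (σ.rayTo o (.ofPoint x) t) l := by
  have hst' : (s : ℝ) ≤ t := hst
  have hqt : (q : ℝ) ≤ t := by nlinarith [hl.2]
  rw [rayTo_ofPoint_of_le hx (hqt.trans ht), rayTo_ofPoint_of_le hx (hst'.trans ht),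
    rayTo_ofPoint_of_le hx ht, hσ o x _ (div_mem_Icc hx s.coe_nonneg (hst'.trans ht)) _
      (div_mem_Icc hx t.coe_nonneg ht) (by gcongr) l hl, hq]
  congr 1
  ring

/-- If `x` lies on the distinguished geodesic from `o` to `y`, then the generalized rays from `o` to
`x` and to `y` agree until they reach `x`. -/
theorem IsConsistent.rayTo_eq_rayTo (hσ : σ.IsConsistent) {o x y : X} {r : ℝ}
    (hr : r ∈ Icc (0 : ℝ) 1) (hxy : x = σ.toFun o y r) (hx : 0 < dist o x) {t : ℝ≥0}
    (ht : (t : ℝ) ≤ dist o x) : σ.rayTo o (.ofPoint x) t = σ.rayTo o (.ofPoint y) t := by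
  have hL : dist o x = r * dist o y := by rw [hxy, dist_left_toFun o y hr]
  have hle : dist o x ≤ dist o y := by
    rw [hL]; exact mul_le_of_le_one_left dist_nonneg hr.2
  have hr0 : r ≠ 0 := by rintro rfl; simp [hL] at hx
  have h := hσ o y 0 (by simp) r hr hr.1 _ (div_mem_Icc hx t.coe_nonneg ht)
  rw [σ.map_zero, ← hxy] at h
  rw [rayTo_ofPoint_of_le hx ht, rayTo_ofPoint_of_le (hx.trans_le hle) (ht.trans hle), h]
  congr 1
  rw [hL]
  field_simp [(hx.trans_le hle).ne']
  ring

/-- A distinguished geodesic depends continuously on its endpoints. -/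
theorem IsConical.tendsto_toFun (hσ : σ.IsConical) {ι : Type*} {U : Filter ι} {a b : ι → X}
    {x y : X} (ha : Tendsto a U (𝓝 x)) (hb : Tendsto b U (𝓝 y)) {l : ℝ}
    (hl : l ∈ Icc (0 : ℝ) 1) :
    Tendsto (fun i => σ.toFun (a i) (b i) l) U (𝓝 (σ.toFun x y l)) := by
  rw [tendsto_iff_dist_tendsto_zero] at *
  refine squeeze_zero (fun _ => dist_nonneg) (fun i => hσ _ _ _ _ l hl) ?_
  simpa using (ha.const_mul (1 - l)).add (hb.const_mul l)

/-- In a proper space, distinguished geodesics from `o` to points `x i` that escape to infinity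
converge, along any ultrafilter, to a `σ`-ray issuing from `o`. -/
theorem exists_tendsto_ray [ProperSpace X] (hσ : σ.IsConical) (hσ' : σ.IsConsistent)
    {ι : Type*} (U : Ultrafilter ι) (o : X) (x : ι → X)
    (hx : Tendsto (fun i => dist o (x i)) U atTop) :
    ∃ ξ : σ.Ray, ξ.toFun 0 = o ∧
      ∀ t, Tendsto (fun i => σ.rayTo o (.ofPoint (x i)) t) U (𝓝 (ξ.toFun t)) := by
  have key : ∀ t, ∃ a, Tendsto (fun i => σ.rayTo o (.ofPoint (x i)) t) U (𝓝 a) := fun t => by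
    obtain ⟨a, -, ha⟩ := (isCompact_closedBall o (t : ℝ)).ultrafilter_le_nhds
      (U.map fun i => σ.rayTo o (.ofPoint (x i)) t)
      (tendsto_principal.2 <| Eventually.of_forall fun i => by
        have := (lipschitzWith_rayTo_ofPoint (σ := σ) o (x i)).dist_le_mul t 0
        simpa [rayTo_ofPoint_zero, NNReal.dist_eq] using this)
    exact ⟨a, ha⟩
  choose ξ hξ using key
  have hpos : ∀ᶠ i in (U : Filter ι), 0 < dist o (x i) := hx.eventually_gt_atTop 0
  refine ⟨⟨ξ, Isometry.of_dist_eq fun s t => ?_, fun s t q hst l hl hq => ?_⟩, ?_, hξ⟩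
  · refine tendsto_nhds_unique_of_eventuallyEq ((hξ s).dist (hξ t)) tendsto_const_nhds ?_
    filter_upwards [hpos, hx.eventually_ge_atTop s, hx.eventually_ge_atTop t] with i h0 hs ht
    exact dist_rayTo_ofPoint h0 hs ht
  · refine tendsto_nhds_unique_of_eventuallyEq (hξ q) (hσ.tendsto_toFun (hξ s) (hξ t) hl) ?_
    filter_upwards [hpos, hx.eventually_ge_atTop t] with i h0 ht
    exact hσ'.rayTo_ofPoint h0 hst ht hl hq
  · refine tendsto_nhds_unique (hξ 0) ?_
    simp only [rayTo_ofPoint_zero]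
    exact tendsto_const_nhds

/-! ### Points at infinity -/

/-- Two asymptotic `σ`-rays with the same origin coincide: by conicality their distance at time `s`
is at most `s / t` times their distance at a later time `t`, which is bounded. -/
theorem IsConical.ray_eq (hσ : σ.IsConical) {ξ η : σ.Ray} (h0 : ξ.toFun 0 = η.toFun 0)
    (h : ξ.endpoint = η.endpoint) : ξ.toFun = η.toFun := by
  obtain ⟨C, hC⟩ : ∃ C : ℝ, ∀ t, dist (ξ.toFun t) (η.toFun t) ≤ C := Quotient.exact h
  funext s
  have hlim : Tendsto (fun t : ℝ≥0 => (s : ℝ) / t * C) atTop (𝓝 0) := by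
    simpa using ((NNReal.tendsto_coe_atTop.2 tendsto_id).const_div_atTop (s : ℝ)).mul_const C
  refine dist_le_zero.1 (ge_of_tendsto hlim ?_)
  filter_upwards [eventually_ge_atTop s, eventually_gt_atTop 0] with t hst ht
  have ht' : (0 : ℝ) < t := ht
  have hl := div_mem_Icc ht' s.coe_nonneg (NNReal.coe_le_coe.2 hst)
  have hs : (s : ℝ) = (1 - (s : ℝ) / t) * (0 : ℝ≥0) + (s : ℝ) / t * t := by
    rw [NNReal.coe_zero, mul_zero, zero_add, div_mul_cancel₀ _ ht'.ne']
  rw [ξ.map_eq 0 t s zero_le _ hl hs, η.map_eq 0 t s zero_le _ hl hs, h0]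
  refine (hσ _ _ _ _ _ hl).trans ?_
  rw [dist_self, mul_zero, zero_add]
  exact mul_le_mul_of_nonneg_left (hC t) hl.1

theorem IsConical.rayTo_endpoint (hσ : σ.IsConical) (ξ : σ.Ray) :
    σ.rayTo (ξ.toFun 0) (.ofBoundary ξ.endpoint) = ξ.toFun := by
  have h : ∃ η : σ.Ray, η.toFun 0 = ξ.toFun 0 ∧ η.endpoint = ξ.endpoint := ⟨ξ, rfl, rfl⟩
  rw [rayTo, dif_pos h]
  exact hσ.ray_eq h.choose_spec.1 h.choose_spec.2

/-- The only point of the visual compactification with generalized ray `ξ` is the class of `ξ`: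
generalized rays to points of `X` are eventually constant. -/
theorem eq_ofBoundary_endpoint {ξ : σ.Ray} {o : X} {z : σ.VisualCompactification}
    (hz : σ.rayTo o z = ξ.toFun) : z = .ofBoundary ξ.endpoint := by
  have hinj : Function.Injective ξ.toFun := ξ.isometry.injective
  rcases z with x | w
  · exfalso
    have h : ξ.toFun (nndist o x) = ξ.toFun (nndist o x + 1) := by
      rw [← hz, rayTo_ofPoint_of_ge (by simp), rayTo_ofPoint_of_ge (by simp)]
    simpa using hinj h
  · by_cases h : ∃ η : σ.Ray, η.toFun 0 = o ∧ η.endpoint = w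
    · rw [rayTo, dif_pos h] at hz
      have hη : h.choose = ξ := by
        cases hc : h.choose
        cases ξ
        simp_all
      rw [← h.choose_spec.2, hη]
    · rw [rayTo, dif_neg h] at hz
      have h01 : ξ.toFun 0 = ξ.toFun 1 := by rw [← hz]
      exact (zero_ne_one (hinj h01)).elim

/-- For points of `X`, convergence in the cone topology is pointwise convergence of the generalized
rays, because these are equicontinuous. -/
theorem tendsto_coneTopology {ι : Type*} {U : Filter ι} {o : X} {x : ι → X}
    {z : σ.VisualCompactification}
    (h : ∀ t, Tendsto (fun i => σ.rayTo o (.ofPoint (x i)) t) U (𝓝 (σ.rayTo o z t))) :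
    Tendsto (fun i => VisualCompactification.ofPoint (x i)) U (@nhds _ (σ.coneTopology o) z) := by
  rw [nhds_induced, tendsto_comap_iff]
  have heq : Equicontinuous fun i => σ.rayTo o (.ofPoint (x i)) :=
    (LipschitzWith.uniformEquicontinuous _ 1 fun i =>
      lipschitzWith_rayTo_ofPoint o (x i)).equicontinuous
  exact (EquicontinuousOn.tendsto_uniformOnFun_iff_pi (𝔖 := {K : Set ℝ≥0 | IsCompact K})
    (fun K hK => hK) (sUnion_eq_univ_iff.2 fun t => ⟨{t}, isCompact_singleton, rfl⟩)
    (fun K _ => heq.equicontinuousOn K) U (σ.rayTo o z)).2 (tendsto_pi_nhds.2 h)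

theorem tendsto_rayTo_of_tendsto {ι : Type*} {U : Filter ι} {o : X}
    {w : ι → σ.VisualCompactification} {z : σ.VisualCompactification}
    (h : Tendsto w U (@nhds _ (σ.coneTopology o) z)) (t : ℝ≥0) :
    Tendsto (fun i => σ.rayTo o (w i) t) U (𝓝 (σ.rayTo o z t)) := by
  rw [nhds_induced, tendsto_comap_iff] at h
  rw [UniformOnFun.tendsto_iff_tendstoUniformlyOn] at h
  exact (h {t} isCompact_singleton).tendsto_at (mem_singleton t)

/-! ### Fixed points in the visual compactification -/

/-- For `r < 1` there is a point `x` with `x = σ_{o, Tx}(r)`, by Banach's fixed point theorem. -/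
theorem IsConical.exists_eq_toFun [CompleteSpace X] (hσ : σ.IsConical) (T : X ≃ᵢ X) (o : X)
    {r : ℝ} (hr : r ∈ Ico (0 : ℝ) 1) : ∃ x, x = σ.toFun o (T x) r := by
  lift r to ℝ≥0 using hr.1
  have hne : Nonempty X := ⟨o⟩
  have hc : ContractingWith r fun x => σ.toFun o (T x) r := by
    refine ⟨by exact_mod_cast hr.2, LipschitzWith.of_dist_le_mul fun x y => ?_⟩
    have := hσ o (T x) o (T y) r ⟨hr.1, hr.2.le⟩
    rwa [dist_self, mul_zero, zero_add, T.dist_eq] at this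
  exact ⟨hc.fixedPoint, hc.fixedPoint_isFixedPt.symm⟩

/-- Either `T` fixes a point of `X`, or points `x i` with `x i` on the distinguished geodesic from
`o` to `T (x i)` converge together with their images under `T` to one point at infinity. -/
theorem exists_fixed_or_ray [ProperSpace X] (hσ : σ.IsConical) (hσ' : σ.IsConsistent)
    (T : X ≃ᵢ X) (o : X) :
    (∃ x, T x = x) ∨ ∃ (U : Ultrafilter ℝ) (x : ℝ → X) (ξ : σ.Ray), ξ.toFun 0 = o ∧
      Tendsto (fun i => dist o (x i)) U atTop ∧
      (∀ t, Tendsto (fun i => σ.rayTo o (.ofPoint (x i)) t) U (𝓝 (ξ.toFun t))) ∧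
      ∀ t, Tendsto (fun i => σ.rayTo o (.ofPoint (T (x i))) t) U (𝓝 (ξ.toFun t)) := by
  have key : ∀ r : ℝ, ∃ x, r ∈ Ico (0 : ℝ) 1 → x = σ.toFun o (T x) r := fun r => by
    by_cases hr : r ∈ Ico (0 : ℝ) 1
    · obtain ⟨x, hx⟩ := hσ.exists_eq_toFun T o hr
      exact ⟨x, fun _ => hx⟩
    · exact ⟨o, fun h => (hr h).elim⟩
  choose x hx using key
  set U : Ultrafilter ℝ := Ultrafilter.of (𝓝[<] 1)
  have hU : (U : Filter ℝ) ≤ 𝓝[<] 1 := Ultrafilter.of_le _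
  have hI : ∀ᶠ r in (U : Filter ℝ), r ∈ Ico (0 : ℝ) 1 := hU (Ico_mem_nhdsLT zero_lt_one)
  by_cases hb : Tendsto (fun r => dist o (x r)) U atTop
  · right
    obtain ⟨ξ, hξ0, hξ⟩ := exists_tendsto_ray hσ hσ' U o x hb
    refine ⟨U, x, ξ, hξ0, hb, hξ, fun t => (hξ t).congr' ?_⟩
    filter_upwards [hI, hb.eventually_gt_atTop 0, hb.eventually_ge_atTop t] with r hr h0 ht
    exact hσ'.rayTo_eq_rayTo ⟨hr.1, hr.2.le⟩ (hx r hr) h0 ht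
  · left
    simp only [tendsto_atTop, not_forall] at hb
    obtain ⟨C, hC⟩ := hb
    rw [← Ultrafilter.eventually_not] at hC
    obtain ⟨a, -, ha⟩ := (isCompact_closedBall o C).ultrafilter_le_nhds (U.map x)
      (tendsto_principal.2 <| hC.mono fun r hr => by
        rw [Metric.mem_closedBall']; exact (not_le.1 hr).le)
    have ha : Tendsto x U (𝓝 a) := ha
    have hTa : Tendsto (fun r => T (x r)) U (𝓝 (T a)) := (T.continuous.tendsto a).comp ha
    have hlim : Tendsto (fun r : ℝ => (1 - r) * dist o (T (x r))) U (𝓝 0) := by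
      have h1 : Tendsto (fun r : ℝ => 1 - r) U (𝓝 (1 - 1)) :=
        tendsto_const_nhds.sub (hU.trans nhdsWithin_le_nhds)
      simpa using h1.mul (tendsto_const_nhds.dist hTa)
    refine ⟨a, (dist_eq_zero.1 (tendsto_nhds_unique_of_eventuallyEq (ha.dist hTa) hlim ?_)).symm⟩
    filter_upwards [hI] with r hr
    have h := dist_toFun_right (σ := σ) o (T (x r)) ⟨hr.1, hr.2.le⟩
    rwa [← hx r hr] at h

theorem exists_act_eq [ProperSpace X] [Nonempty X] (hσ : σ.IsConical) (hσ' : σ.IsConsistent)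
    (T : X ≃ᵢ X) (hT : σ.IsEquivariant T) :
    ∃ z : σ.VisualCompactification, VisualCompactification.act T hT z = z := by
  obtain ⟨o⟩ := ‹Nonempty X›
  rcases exists_fixed_or_ray hσ hσ' T o with ⟨x, hx⟩ | ⟨U, x, ξ, -, hx, h1, h2⟩
  · exact ⟨.ofPoint x, congrArg _ hx⟩
  suffices h : ∀ t, dist (T (ξ.toFun t)) (ξ.toFun t) ≤ 2 * dist o (T o) from
    ⟨.ofBoundary ξ.endpoint, congrArg VisualCompactification.ofBoundary <|
      Quotient.sound (s := σ.asymptotic) (a := ξ.map T hT) ⟨_, h⟩⟩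
  intro t
  refine le_of_tendsto (((T.continuous.tendsto _).comp (h1 t)).dist (h2 t)) ?_
  have hTx : Tendsto (fun i => dist o (T (x i))) U atTop := by
    refine tendsto_atTop_mono (fun i => ?_) (tendsto_atTop_add_const_right _ (-dist o (T o)) hx)
    linarith [dist_triangle (T o) o (T (x i)), T.dist_eq o (x i), dist_comm o (T o)]
  filter_upwards [hx.eventually_gt_atTop 0, hx.eventually_ge_atTop t, hTx.eventually_gt_atTop 0,
    hTx.eventually_ge_atTop t] with i p1 q1 p2 q2
  have m1 := div_mem_Icc p1 t.coe_nonneg q1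
  have m2 := div_mem_Icc p2 t.coe_nonneg q2
  simp only [Function.comp_apply]
  rw [rayTo_ofPoint_of_le p1 q1, rayTo_ofPoint_of_le p2 q2, hT _ _ _ m1]
  -- Compare both points with the point at parameter `t / d(o, Tx)` on the geodesic from `T o`.
  have h3 := hσ (T o) (T (x i)) o (T (x i)) _ m2
  have h4 := σ.dist_map (T o) (T (x i)) _ m1 _ m2
  have h5 : |(t : ℝ) / dist o (x i) - t / dist o (T (x i))| * dist (T o) (T (x i)) ≤
      dist o (T o) := by
    have e : ((t : ℝ) / dist o (x i) - t / dist o (T (x i))) * dist o (x i) =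
        t / dist o (T (x i)) * (dist o (T (x i)) - dist o (x i)) := by
      field_simp
    rw [T.dist_eq, ← abs_of_pos p1, ← abs_mul, abs_of_pos p1, e, abs_mul, abs_of_nonneg m2.1]
    refine (mul_le_of_le_one_left (abs_nonneg _) m2.2).trans ?_
    rw [← T.dist_eq o (x i)]
    exact abs_dist_sub_le _ _ _
  rw [dist_self, mul_zero, add_zero] at h3
  have h6 := mul_le_of_le_one_left (dist_nonneg (x := T o) (y := o)) (sub_le_self 1 m2.1)
  rw [dist_comm (T o) o] at h3 h6
  refine (dist_triangle _ (σ.toFun (T o) (T (x i)) (t / dist o (T (x i)))) _).trans ?_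
  linarith

theorem exists_fixed_of_continuous [ProperSpace X] (hσ : σ.IsConical) (hσ' : σ.IsConsistent)
    (T : X ≃ᵢ X) (o : X) (F : σ.VisualCompactification → σ.VisualCompactification)
    (hF : Continuous[σ.coneTopology o, σ.coneTopology o] F)
    (hFT : ∀ x : X, F (.ofPoint x) = .ofPoint (T x)) :
    ∃ z : σ.VisualCompactification, F z = z := by
  rcases exists_fixed_or_ray hσ hσ' T o with ⟨x, hx⟩ | ⟨U, x, ξ, rfl, -, h1, h2⟩
  · exact ⟨.ofPoint x, by rw [hFT, hx]⟩
  have h1' := fun t => (congrFun (hσ.rayTo_endpoint ξ) t).symm ▸ h1 t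
  refine ⟨.ofBoundary ξ.endpoint, eq_ofBoundary_endpoint (o := ξ.toFun 0) (funext fun t => ?_)⟩
  let _ := σ.coneTopology (ξ.toFun 0)
  have h3 := (hF.tendsto _).comp (tendsto_coneTopology h1')
  have h4 := tendsto_rayTo_of_tendsto h3 t
  simp only [Function.comp_apply, hFT] at h4
  exact tendsto_nhds_unique h4 (h2 t)

end GeodesicBicombing

/-- Every isometry of an injective metric space fixes a point of the metric compactification.  If
the space is proper, then every isometry that acts on the visual compactification (given by a
conical and consistent bicombing `σ`) fixes a point of it: this holds for the action
`x ↦ Tx`, `[ξ] ↦ [T ∘ ξ]` of an isometry preserving `σ`, and, with no equivariance of `σ`, for every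
continuous extension of `T` to the visual compactification. -/
theorem corollary1p6 {X : Type u} [MetricSpace X] (hX : IsInjectiveMetricSpace X) :
    (∀ (x₀ : X) (T : X ≃ᵢ X), ∃ h : MetricCompactification x₀,
      MetricCompactification.act T h = h) ∧
    (ProperSpace X → ∀ σ : GeodesicBicombing X, σ.IsConical → σ.IsConsistent →
      ∀ T : X ≃ᵢ X,
        (∀ hT : σ.IsEquivariant T, ∃ z : σ.VisualCompactification,
          GeodesicBicombing.VisualCompactification.act T hT z = z) ∧
        (∀ (o : X) (F : σ.VisualCompactification → σ.VisualCompactification),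
          Continuous[σ.coneTopology o, σ.coneTopology o] F →
          (∀ x : X, F (.ofPoint x) = .ofPoint (T x)) →
          ∃ z : σ.VisualCompactification, F z = z)) := by
  refine ⟨hX.exists_act_eq, fun hP σ hσ hσ' T => ⟨fun hT => ?_, fun o F hF hFT => ?_⟩⟩
  · have := hX.nonempty
    exact GeodesicBicombing.exists_act_eq hσ hσ' T hT
  · exact GeodesicBicombing.exists_fixed_of_continuous hσ hσ' T o F hF hFT
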